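/- Given a family $\mathcal F$ of finite graphs, the $\mathcal F$-saturation game on $n$ vertices is played by two players, Max and Mini. Starting with Max, they alternately add an edge to an initially empty graph on $n$ vertices, subject to the sole constraint that the graph never contains a (not necessarily induced) subgraph isomorphic to a member of $\mathcal F$. The game ends when no further edge can be added. Max wants the final graph to have as many edges as possible and Mini as few as possible; $\mathrm{sat}_g(n,\mathcal F)$ denotes the number of edges of the final graph when both players play optimally. Let $C_\ell$ denote the cycle of length $\ell$. Theorem. Let $\mathcal C$ be a (finite or infinite) family of cycles $C_\ell$, $\ell\ge 3$, with $C_3\notin\mathcal C$, and suppose that there is an integer $k\ge 3$ such that for every integer $\ell\ge k$ at least one of $C_\ell$, $C_{\ell+1}$ lies in $\mathcal C$. Then for every integer $n\ge 1$, $$\mathrm{sat}_g(n,\mathcal C)\le \tfrac12(3k-1)(n-1).$$ -/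

import Mathlib

/-- Finite graphs, with vertex set `Fin m` for some `m`. -/
abbrev FinGraph : Type := Σ m : ℕ, SimpleGraph (Fin m)

/-- The cycle `C_ℓ` on `ℓ` vertices (a genuine cycle when `3 ≤ ℓ`). -/
def cyc (ℓ : ℕ) : FinGraph := ⟨ℓ, SimpleGraph.cycleGraph ℓ⟩

/-- A family of cycles: every member is `C_ℓ` for some `ℓ ≥ 3`. The family may be infinite. -/
def IsCycleFamily (𝓒 : Set FinGraph) : Prop :=
  ∀ F ∈ 𝓒, ∃ ℓ : ℕ, 3 ≤ ℓ ∧ F = cyc ℓ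

/-- `G` has no (not necessarily induced) subgraph isomorphic to a member of `𝓕`. -/
def FamilyFree {V : Type*} (𝓕 : Set FinGraph) (G : SimpleGraph V) : Prop :=
  ∀ F ∈ 𝓕, F.2.Free G

/-- A legal move of the `𝓕`-saturation game: `H` is `G` plus one new edge, and `H` is `𝓕`-free. -/
def LegalMove {V : Type*} (𝓕 : Set FinGraph) (G H : SimpleGraph V) : Prop :=
  ∃ u v : V, u ≠ v ∧ ¬ G.Adj u v ∧ H = G ⊔ SimpleGraph.edge u v ∧ FamilyFree 𝓕 H

theorem LegalMove.lt {V : Type*} {𝓕 : Set FinGraph} {G H : SimpleGraph V}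
    (h : LegalMove 𝓕 G H) : G < H := by
  obtain ⟨u, v, huv, hG, rfl, -⟩ := h
  refine lt_of_le_of_ne le_sup_left fun he => hG ?_
  rw [he]
  simp [SimpleGraph.edge_adj, huv]

/-- The two players: `mx` wants many edges in the final graph, `mini` wants few. -/
inductive Player where
  | mx
  | mini

open Classical in
/-- The number of edges of the final graph of the `𝓕`-saturation game under optimal play, when the
current graph is `G` and the given player moves next. The players alternate, a player with a legal
move has to make one, and the game ends when there is none. (There are finitely many moves, so the
supremum and the infimum of these natural numbers are a maximum and a minimum.) -/
noncomputable def gameValue {V : Type*} [Finite V] (𝓕 : Set FinGraph) (p : Player)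
    (G : SimpleGraph V) : ℕ :=
  if ∃ H, LegalMove 𝓕 G H then
    match p with
    | .mx => ⨆ H : {H : SimpleGraph V // LegalMove 𝓕 G H}, gameValue 𝓕 .mini H.1
    | .mini => ⨅ H : {H : SimpleGraph V // LegalMove 𝓕 G H}, gameValue 𝓕 .mx H.1
  else G.edgeSet.ncard
termination_by (wellFounded_gt : WellFounded ((· > ·) : SimpleGraph V → SimpleGraph V → Prop)).wrap G
decreasing_by
  all_goals exact H.2.lt

/-- The game saturation number `sat_g(n, 𝓕)`: the game starts from the empty graph on `n` vertices,
and Max makes the first move. -/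
noncomputable def satGame (n : ℕ) (𝓕 : Set FinGraph) : ℕ :=
  gameValue 𝓕 Player.mx (⊥ : SimpleGraph (Fin n))

/-! Mini keeps a triangle in every block that is not a single bridge. Blocks are handled through
`CyclicPair`, which is symmetric and transitive; a bridge is an edge not related to itself. A new
edge can create a triangle-free block only by closing a path of at least three bridges
(`BlocksHaveTriangle.sup_edge`), so Mini also ensures that no path of four bridges is present when
Max moves. At worst Max then closes a four-cycle, to which Mini adds a chord. Otherwise Mini closes
a triangle over two adjacent bridges, or moves arbitrarily if there are none. The triangle-closing
moves are legal because every new cycle is a triangle, and `C_3` is not forbidden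
(`IsCycleFamily.exists_response`).

In the final graph, no two consecutive lengths that are at least `k` both occur as cycle lengths. A
path joining two vertices of a triangle and avoiding the third closes up to two consecutive lengths,
so it is short. Linking a cycle to a triangle of its block then bounds all cycle lengths below `3 *
k` (`NoConsecutiveCycles.length_lt`). An end of a longest path has all its neighbours on the path,
and two consecutive ones form a triangle with it; counting positions bounds its degree by `(3 * k -
1) / 2` (`NoConsecutiveCycles.exists_degree_le`). Deleting such vertices one by one gives the edge
bound. -/

namespace SimpleGraph

/-! ### Cycles, arcs and blocks -/

variable {V : Type*} {G : SimpleGraph V}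

/-- Two distinct vertices of a cycle split it into two internally disjoint arcs. -/
theorem Walk.IsCycle.exists_arcs {u p q : V} {C : G.Walk u u} (hC : C.IsCycle)
    (hp : p ∈ C.support) (hq : q ∈ C.support) (hpq : p ≠ q) :
    ∃ A B : G.Walk p q, A.IsPath ∧ B.IsPath ∧
      (∀ x ∈ A.support, x ∈ B.support → x = p ∨ x = q) ∧
      (∀ x, x ∈ C.support ↔ x ∈ A.support ∨ x ∈ B.support) ∧
      (∀ e, e ∈ C.edges ↔ e ∈ A.edges ∨ e ∈ B.edges) ∧
      A.length + B.length = C.length := by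
  classical
  have hC' : (C.rotate p hp).IsCycle := (Walk.isCycle_rotate hp).2 hC
  have hq' : q ∈ (C.rotate p hp).support := (Walk.mem_support_rotate_iff _ _ _).2 hq
  have hs : ∀ x, x ∈ (C.rotate p hp).support ↔ x ∈ C.support := fun x =>
    Walk.mem_support_rotate_iff _ _ _
  have he : ∀ e, e ∈ (C.rotate p hp).edges ↔ e ∈ C.edges := fun e =>
    (C.rotate_edges p hp).mem_iff
  have hl := C.length_rotate p hp
  generalize C.rotate p hp = C' at *
  obtain ⟨A, B, rfl⟩ := Walk.mem_support_iff_exists_append.1 hq'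
  have hA : ¬ A.Nil := fun h => hpq h.eq
  have hB : ¬ B.Nil := fun h => hpq h.eq.symm
  have hAp := hC'.isPath_of_append_left hB
  have hBp := hC'.isPath_of_append_right hA
  refine ⟨A, B.reverse, hAp, hBp.reverse, ?_, ?_, ?_, ?_⟩
  · intro x hxA hxB
    have hd := hC'.2
    rw [Walk.tail_support_append, List.nodup_append'] at hd
    rw [Walk.support_reverse, List.mem_reverse, Walk.mem_support_iff] at hxB
    rw [Walk.mem_support_iff] at hxA
    rcases hxA with h | h
    · exact .inl h
    rcases hxB with h' | h'
    · exact .inr h'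
    exact (hd.2.2 h h').elim
  · intro x
    rw [← hs x]; simp [Walk.mem_support_append_iff]
  · intro e
    rw [← he e]; simp
  · rw [← hl]; simp

/-- Two internally disjoint paths with the same ends form a cycle. -/
theorem Walk.IsPath.exists_isCycle_of_disjoint {p q : V} {A B : G.Walk p q} (hA : A.IsPath)
    (hB : B.IsPath) (hAB : ∀ x ∈ A.support, x ∈ B.support → x = p ∨ x = q)
    (hpq : p ≠ q) (hl : 3 ≤ A.length + B.length) :
    ∃ C : G.Walk p p, C.IsCycle ∧ (∀ e, e ∈ C.edges ↔ e ∈ A.edges ∨ e ∈ B.edges) ∧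
      C.length = A.length + B.length := by
  refine ⟨A.append B.reverse, hA.isCycle_append hB.reverse ?_ ?_, by simp, by simp⟩
  · intro x hx hx'
    have h1 : x ≠ p := by
      rintro rfl
      have := hA.support_nodup
      rw [← Walk.cons_tail_support] at this
      exact (List.nodup_cons.1 this).1 hx
    have h2 : x ≠ q := by
      rintro rfl
      have := hB.reverse.support_nodup
      rw [← Walk.cons_tail_support] at this
      exact (List.nodup_cons.1 this).1 hx'
    have h3 : x ∈ B.reverse.support := List.mem_of_mem_tail hx'
    rw [Walk.support_reverse, List.mem_reverse] at h3
    exact (hAB x (List.mem_of_mem_tail hx) h3).elim h1 h2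
  · simp only [Walk.length_reverse]; omega

/-- A walk meeting a set splits at its first vertex in the set. -/
theorem Walk.exists_append_first_mem (S : Set V) {u v : V} (p : G.Walk u v)
    (h : ∃ z ∈ p.support, z ∈ S) :
    ∃ w ∈ S, ∃ (p₁ : G.Walk u w) (p₂ : G.Walk w v), p = p₁.append p₂ ∧
      ∀ z ∈ p₁.support, z ∈ S → z = w := by
  induction p with
  | nil =>
    obtain ⟨z, hz, hzS⟩ := h
    simp only [Walk.support_nil, List.mem_singleton] at hz
    subst hz
    exact ⟨z, hzS, .nil, .nil, rfl, by simp⟩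
  | @cons a b c hab p ih =>
    by_cases ha : a ∈ S
    · exact ⟨a, ha, .nil, .cons hab p, rfl, by simp⟩
    · obtain ⟨w, hw, p₁, p₂, rfl, h'⟩ := ih (by
        obtain ⟨z, hz, hzS⟩ := h
        rw [Walk.support_cons, List.mem_cons] at hz
        rcases hz with rfl | hz
        · exact (ha hzS).elim
        · exact ⟨z, hz, hzS⟩)
      refine ⟨w, hw, .cons hab p₁, p₂, rfl, ?_⟩
      intro z hz hzS
      rw [Walk.support_cons, List.mem_cons] at hz
      rcases hz with rfl | hz
      · exact (ha hzS).elim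
      · exact h' z hz hzS

/-- If a cycle through the edge `xy` meets `S` in two vertices, then there are disjoint paths from
`x` and `y` to `S`. -/
theorem Walk.IsCycle.exists_disjoint_paths (S : Set V) {u x y : V} {D : G.Walk u u}
    (hD : D.IsCycle) (hxy : s(x, y) ∈ D.edges) {a b : V} (ha : a ∈ D.support) (hb : b ∈ D.support)
    (haS : a ∈ S) (hbS : b ∈ S) (hab : a ≠ b) :
    ∃ p ∈ S, ∃ q ∈ S, ∃ (P : G.Walk x p) (Q : G.Walk y q), P.IsPath ∧ Q.IsPath ∧
      (∀ z ∈ P.support, z ∉ Q.support) ∧ (∀ z ∈ P.support, z ∈ S → z = p) ∧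
      (∀ z ∈ Q.support, z ∈ S → z = q) := by
  have hadj := D.adj_of_mem_edges hxy
  -- Removing the edge `xy` turns `D` into a path `R`; `P` and `Q` are its pieces from the two ends
  -- up to the first vertex of `S`.
  obtain ⟨R, hR, hRs⟩ : ∃ R : G.Walk x y, R.IsPath ∧ ∀ z ∈ D.support, z ∈ R.support := by
    obtain ⟨A, B, hA, hB, -, hs, he, -⟩ := hD.exists_arcs
      (D.fst_mem_support_of_mem_edges hxy) (D.snd_mem_support_of_mem_edges hxy) hadj.ne
    rcases (he _).1 hxy with h | h
    · refine ⟨B, hB, fun z hz => ?_⟩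
      rcases (hs z).1 hz with h' | h'
      · rw [hA.eq_adj_toWalk_of_mem_edges h] at h'
        simp at h'
        rcases h' with rfl | rfl <;> simp
      · exact h'
    · refine ⟨A, hA, fun z hz => ?_⟩
      rcases (hs z).1 hz with h' | h'
      · exact h'
      · rw [hB.eq_adj_toWalk_of_mem_edges h] at h'
        simp at h'
        rcases h' with rfl | rfl <;> simp
  have haR := hRs a ha
  have hbR := hRs b hb
  obtain ⟨p, hp, P, R', rfl, hP⟩ := R.exists_append_first_mem S ⟨a, haR, haS⟩
  obtain ⟨q, hq, Q, M, hM, hQ⟩ := R'.reverse.exists_append_first_mem S ⟨p, by simp, hp⟩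
  have hR'p : R'.IsPath := hR.of_append_right
  have hQM : (Q.append M).IsPath := hM ▸ hR'p.reverse
  have hsupp : ∀ z, z ∈ R'.support ↔ z ∈ Q.support ∨ z ∈ M.support := by
    intro z
    have := congrArg (fun w => z ∈ w.support) hM
    simpa [Walk.mem_support_append_iff] using this
  have hpq : p ≠ q := by
    rintro rfl
    have hMn : M = .nil := (Walk.isPath_iff_nil.1 hQM.of_append_right).eq_nil
    have key : ∀ z ∈ (P.append R').support, z ∈ S → z = p := by
      intro z hz hzS
      rw [Walk.mem_support_append_iff, hsupp] at hz
      rcases hz with h | h | h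
      · exact hP z h hzS
      · exact hQ z h hzS
      · subst hMn; simpa using h
    exact hab ((key a haR haS).trans (key b hbR hbS).symm)
  refine ⟨p, hp, q, hq, P, Q, hR.of_append_left, hQM.of_append_left, ?_, hP, hQ⟩
  intro z hzP hzQ
  have hzR : z ∈ R'.support := (hsupp z).2 (.inl hzQ)
  have hnd := hR.support_nodup
  rw [Walk.support_append, List.nodup_append'] at hnd
  rw [Walk.mem_support_iff] at hzR
  rcases hzR with rfl | hzR
  · exact hpq (hQ z hzQ hp)
  · exact hnd.2.2 hzP hzR

/-- The edges `e` and `f` lie on a common cycle. -/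
def CyclicPair (G : SimpleGraph V) (e f : Sym2 V) : Prop :=
  ∃ (u : V) (C : G.Walk u u), C.IsCycle ∧ e ∈ C.edges ∧ f ∈ C.edges

theorem CyclicPair.symm {e f : Sym2 V} (h : G.CyclicPair e f) : G.CyclicPair f e := by
  obtain ⟨u, C, hC, he, hf⟩ := h
  exact ⟨u, C, hC, hf, he⟩

theorem CyclicPair.left {e f : Sym2 V} (h : G.CyclicPair e f) : G.CyclicPair e e := by
  obtain ⟨u, C, hC, he, hf⟩ := h
  exact ⟨u, C, hC, he, he⟩

theorem CyclicPair.mono {H : SimpleGraph V} (hGH : G ≤ H) {e f : Sym2 V} (h : G.CyclicPair e f) :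
    H.CyclicPair e f := by
  obtain ⟨u, C, hC, he, hf⟩ := h
  exact ⟨u, C.mapLe hGH, hC.mapLe hGH, by simpa, by simpa⟩

theorem Walk.edges_eq_of_length_eq_one {u v : V} {p : G.Walk u v} (h : p.length = 1) :
    p.edges = [s(u, v)] := by
  cases p with
  | nil => simp at h
  | cons h' p =>
    cases p with
    | nil => simp
    | cons _ _ => simp at h

/-- As `D` meets `C` in both ends of `f`, disjoint paths lead from the ends of `g` to `C`. They form
an ear through `g`, which closes up with the arc of `C` containing `e`. -/
theorem CyclicPair.trans {e f g : Sym2 V} (hef : G.CyclicPair e f) (hfg : G.CyclicPair f g) :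
    G.CyclicPair e g := by
  obtain ⟨u, C, hC, he, hf⟩ := hef
  obtain ⟨v, D, hD, hf', hg⟩ := hfg
  by_cases hgC : g ∈ C.edges
  · exact ⟨u, C, hC, he, hgC⟩
  induction f with | h a b =>
  induction g with | h x y =>
  obtain ⟨p, hp, q, hq, P, Q, hP, hQ, hPQ, hPS, hQS⟩ :=
    hD.exists_disjoint_paths {z | z ∈ C.support} hg (D.fst_mem_support_of_mem_edges hf')
      (D.snd_mem_support_of_mem_edges hf') (C.fst_mem_support_of_mem_edges hf)
      (C.snd_mem_support_of_mem_edges hf) (D.adj_of_mem_edges hf').ne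
  have hpq : p ≠ q := by
    rintro rfl
    exact hPQ p (by simp) (by simp)
  have hxy := D.adj_of_mem_edges hg
  let E : G.Walk p q := P.reverse.append (.cons hxy Q)
  have hE : E.IsPath := by
    rw [Walk.isPath_def, Walk.support_append, List.nodup_append']
    refine ⟨hP.reverse.support_nodup, by simpa using hQ.support_nodup, ?_⟩
    intro z hz hz'
    exact hPQ z (by simpa using hz) (by simpa using hz')
  have hgE : s(x, y) ∈ E.edges := by simp [E]
  have hES : ∀ z ∈ E.support, z ∈ C.support → z = p ∨ z = q := by
    intro z hz hzC
    simp only [E, Walk.mem_support_append_iff, Walk.support_reverse, List.mem_reverse,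
      Walk.support_cons, List.mem_cons] at hz
    rcases hz with h | rfl | h
    · exact .inl (hPS z h hzC)
    · exact .inl (hPS z (by simp) hzC)
    · exact .inr (hQS z h hzC)
  obtain ⟨A, B, hA, hB, -, hs, hed, -⟩ := hC.exists_arcs hp hq hpq
  have key : ∀ A : G.Walk p q, A.IsPath → (∀ z ∈ A.support, z ∈ C.support) →
      (∀ d ∈ A.edges, d ∈ C.edges) → e ∈ A.edges → G.CyclicPair e s(x, y) := by
    intro A hA hAs hAe heA
    -- If both had length one they would be the same edge, placing `g` on `C`.
    have hl : 3 ≤ A.length + E.length := by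
      by_contra hcon
      have h1 : A.length ≠ 0 := fun h => hpq (Walk.eq_of_length_eq_zero h)
      have h2 : E.length ≠ 0 := fun h => hpq (Walk.eq_of_length_eq_zero h)
      have h3 := Walk.edges_eq_of_length_eq_one (p := A) (by omega)
      have h4 := Walk.edges_eq_of_length_eq_one (p := E) (by omega)
      rw [h4, ← h3] at hgE
      exact hgC (hAe _ hgE)
    obtain ⟨F, hF, hFe, -⟩ := hA.exists_isCycle_of_disjoint hE
      (fun z hz hz' => hES z hz' (hAs z hz)) hpq hl
    exact ⟨p, F, hF, (hFe _).2 (.inl heA), (hFe _).2 (.inr hgE)⟩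
  rcases (hed e).1 he with h | h
  · exact key A hA (fun z hz => (hs z).2 (.inl hz)) (fun d hd => (hed d).2 (.inl hd)) h
  · exact key B hB (fun z hz => (hs z).2 (.inr hz)) (fun d hd => (hed d).2 (.inr hd)) h

end SimpleGraph


/-! ### Triangles bound the cycle lengths -/

namespace SimpleGraph

variable {V : Type*} {G : SimpleGraph V}

/-- `G` contains a cycle of length `ℓ`. -/
def HasCycleLength (G : SimpleGraph V) (ℓ : ℕ) : Prop :=
  ∃ (v : V) (C : G.Walk v v), C.IsCycle ∧ C.length = ℓ

/-- `G` does not contain cycles of two consecutive lengths, both at least `k`. -/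
def NoConsecutiveCycles (G : SimpleGraph V) (k : ℕ) : Prop :=
  ∀ ℓ, k ≤ ℓ → G.HasCycleLength ℓ → G.HasCycleLength (ℓ + 1) → False

theorem HasCycleLength.map {W : Type*} {H : SimpleGraph W} (f : G ↪g H) {ℓ : ℕ}
    (h : G.HasCycleLength ℓ) : H.HasCycleLength ℓ := by
  obtain ⟨v, C, hC, rfl⟩ := h
  exact ⟨f v, C.map f.toHom, (Walk.isCycle_map_iff_of_injective f.injective).2 hC, by simp⟩

theorem Walk.IsPath.hasCycleLength {a b : V} {W : G.Walk a b} (hW : W.IsPath) (hab : G.Adj a b)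
    (hl : 2 ≤ W.length) : G.HasCycleLength (W.length + 1) := by
  refine ⟨b, .cons hab.symm W, ?_, by simp⟩
  rw [Walk.cons_isCycle_iff]
  refine ⟨hW, fun h => ?_⟩
  rw [Sym2.eq_swap] at h
  have := hW.length_eq_one_of_mem_edges h
  omega

/-- A path joining two vertices of a triangle and avoiding the third closes up to cycles of two
consecutive lengths. -/
theorem NoConsecutiveCycles.length_add_one_lt {k : ℕ} (hG : G.NoConsecutiveCycles k) (hk : 3 ≤ k)
    {a b c : V} (hab : G.Adj a b) (hac : G.Adj a c) (hbc : G.Adj b c) {W : G.Walk a b}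
    (hW : W.IsPath) (hc : c ∉ W.support) : W.length + 1 < k := by
  by_contra hcon
  refine hG (W.length + 1) (by omega) (hW.hasCycleLength hab (by omega)) ?_
  have hW' : (Walk.cons hac.symm W).IsPath := hW.cons hc
  simpa using hW'.hasCycleLength hbc.symm (by simp; omega)

/-- A triangle reachable from a long cycle along two disjoint paths, with the third vertex off
the cycle and the paths. -/
theorem NoConsecutiveCycles.false_of_disjoint_paths {k : ℕ} (hG : G.NoConsecutiveCycles k)
    (hk : 3 ≤ k) {u : V} {C : G.Walk u u} (hC : C.IsCycle) (hCl : 2 * k ≤ C.length)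
    {a b c p q : V} (hab : G.Adj a b) (hac : G.Adj a c) (hbc : G.Adj b c)
    {P : G.Walk a p} {Q : G.Walk b q} (hP : P.IsPath) (hQ : Q.IsPath)
    (hPQ : ∀ z ∈ P.support, z ∉ Q.support) (hp : p ∈ C.support) (hq : q ∈ C.support)
    (hPC : ∀ z ∈ P.support, z ∈ C.support → z = p) (hQC : ∀ z ∈ Q.support, z ∈ C.support → z = q)
    (hcP : c ∉ P.support) (hcQ : c ∉ Q.support) (hcC : c ∉ C.support) : False := by
  have hpq : p ≠ q := by
    rintro rfl
    exact hPQ p (by simp) (by simp)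
  obtain ⟨A, hA, hAs, hAl⟩ : ∃ A : G.Walk p q, A.IsPath ∧ (∀ z ∈ A.support, z ∈ C.support) ∧
      k ≤ A.length := by
    obtain ⟨A, B, hA, hB, -, hs, -, hl⟩ := hC.exists_arcs hp hq hpq
    rcases le_total k A.length with h | h
    · exact ⟨A, hA, fun z hz => (hs z).2 (.inl hz), h⟩
    · exact ⟨B, hB, fun z hz => (hs z).2 (.inr hz), by omega⟩
  have hAQ : (A.append Q.reverse).IsPath := by
    rw [Walk.isPath_def, Walk.support_append, List.nodup_append']
    refine ⟨hA.support_nodup, hQ.reverse.support_nodup.tail, fun z hz hz' => ?_⟩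
    have h1 : z = q := hQC z (by simpa using List.mem_of_mem_tail hz') (hAs z hz)
    have h2 := hQ.reverse.support_nodup
    rw [← Walk.cons_tail_support] at h2
    exact (List.nodup_cons.1 h2).1 (h1 ▸ hz')
  have hW : (P.append (A.append Q.reverse)).IsPath := by
    rw [Walk.isPath_def, Walk.support_append, List.nodup_append']
    refine ⟨hP.support_nodup, hAQ.support_nodup.tail, fun z hz hz' => ?_⟩
    have h2 := hAQ.support_nodup
    rw [← Walk.cons_tail_support] at h2
    have h3 := List.mem_of_mem_tail hz'
    rw [Walk.mem_support_append_iff, Walk.support_reverse, List.mem_reverse] at h3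
    rcases h3 with h3 | h3
    · exact (List.nodup_cons.1 h2).1 (hPC z hz (hAs z h3) ▸ hz')
    · exact hPQ z hz h3
  have := hG.length_add_one_lt hk hab hac hbc hW (by
    simp only [Walk.mem_support_append_iff, Walk.support_reverse, List.mem_reverse]
    rintro (h | h | h)
    · exact hcP h
    · exact hcC (hAs c h)
    · exact hcQ h)
  simp only [Walk.length_append] at this
  omega

/-- A long cycle cannot contain all vertices of a triangle. -/
theorem NoConsecutiveCycles.false_of_triangle_subset {k : ℕ} (hG : G.NoConsecutiveCycles k)
    (hk : 3 ≤ k) {u : V} {C : G.Walk u u} (hC : C.IsCycle) (hCl : 3 * k ≤ C.length)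
    {a b c : V} (hab : G.Adj a b) (hac : G.Adj a c) (hbc : G.Adj b c)
    (ha : a ∈ C.support) (hb : b ∈ C.support) (hc : c ∈ C.support) : False := by
  obtain ⟨A, B, hA, hB, hAB, hs, -, hl⟩ := hC.exists_arcs ha hb hab.ne
  -- Each of the three arcs cut out by the triangle avoids the third vertex, so it has length at
  -- most `k - 2`.
  have key : ∀ A B : G.Walk a b, A.IsPath → B.IsPath →
      (∀ x ∈ A.support, x ∈ B.support → x = a ∨ x = b) → c ∈ B.support →
      A.length + B.length = C.length → False := by
    intro A B hA hB hAB hcB hl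
    have hcA : c ∉ A.support := fun h => (hAB c h hcB).elim hac.ne' hbc.ne'
    have h1 := hG.length_add_one_lt hk hab hac hbc hA hcA
    obtain ⟨B₁, B₂, hB₁, hB₂, rfl⟩ := hB.mem_support_iff_exists_append.1 hcB
    have h2 := hG.length_add_one_lt hk hac hab hbc.symm hB₁
      (fun h => hB.ne_of_mem_support_of_append hbc.ne h B₂.end_mem_support rfl)
    have h3 := hG.length_add_one_lt hk hbc.symm hac.symm hab.symm hB₂
      (fun h => hB.ne_of_mem_support_of_append hac.ne B₁.start_mem_support h rfl)
    simp only [Walk.length_append] at hl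
    omega
  rcases (hs c).1 hc with h | h
  · exact key B A hB hA (fun x h h' => hAB x h' h) h (by omega)
  · exact key A B hA hB hAB h hl

/-- `f` is an edge of a triangle. -/
def TriangleEdge (G : SimpleGraph V) (f : Sym2 V) : Prop :=
  ∃ a b c, G.Adj a b ∧ G.Adj a c ∧ G.Adj b c ∧ f = s(a, b)

/-- Every edge on a cycle shares a cycle with an edge of a triangle: every block that is not a
single edge contains a triangle. -/
def BlocksHaveTriangle (G : SimpleGraph V) : Prop :=
  ∀ e, G.CyclicPair e e → ∃ f, G.TriangleEdge f ∧ G.CyclicPair e f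

/-- A triangle in the block of a long cycle, if not contained in the cycle, is linked to it by
disjoint paths from `a` and `b`. If `c` obstructs, the vertices exchange roles until the third one
avoids the paths and the cycle; the detour along the longer arc is then too long. -/
theorem NoConsecutiveCycles.length_lt {k : ℕ} (hG : G.NoConsecutiveCycles k)
    (hk : 3 ≤ k) (hT : G.BlocksHaveTriangle) {u : V} {C : G.Walk u u} (hC : C.IsCycle) :
    C.length < 3 * k := by
  by_contra! hCl
  obtain ⟨e, he⟩ : ∃ e, e ∈ C.edges := by
    refine List.exists_mem_of_ne_nil _ fun h => ?_
    have := C.length_edges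
    rw [h] at this
    simp at this
    omega
  obtain ⟨f, ⟨a, b, c, hab, hac, hbc, rfl⟩, v, D, hD, heD, hfD⟩ := hT e ⟨u, C, hC, he, he⟩
  by_cases hall : a ∈ C.support ∧ b ∈ C.support ∧ c ∈ C.support
  · exact hG.false_of_triangle_subset hk hC hCl hab hac hbc hall.1 hall.2.1 hall.2.2
  induction e with | h x y =>
  obtain ⟨p, hp, q, hq, P, Q, hP, hQ, hPQ, hPC, hQC⟩ :=
    hD.exists_disjoint_paths {z | z ∈ C.support} hfD (D.fst_mem_support_of_mem_edges heD)
      (D.snd_mem_support_of_mem_edges heD) (C.fst_mem_support_of_mem_edges he)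
      (C.snd_mem_support_of_mem_edges he) (D.adj_of_mem_edges heD).ne
  have through : ∀ {a b p q : V} (P : G.Walk a p) (Q : G.Walk b q), G.Adj a b → G.Adj a c →
      G.Adj b c → P.IsPath → Q.IsPath → (∀ z ∈ P.support, z ∉ Q.support) → p ∈ C.support →
      q ∈ C.support → (∀ z ∈ P.support, z ∈ C.support → z = p) →
      (∀ z ∈ Q.support, z ∈ C.support → z = q) → c ∈ P.support → False := by
    intro a b p q P Q hab hac hbc hP hQ hPQ hp hq hPC hQC hcP
    obtain ⟨P₁, P₂, hP₁, hP₂, rfl⟩ := hP.mem_support_iff_exists_append.1 hcP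
    have haP₂ : a ∉ P₂.support := fun h =>
      hP.ne_of_mem_support_of_append hac.ne P₁.start_mem_support h rfl
    refine hG.false_of_disjoint_paths hk hC (by omega) hbc.symm hac.symm hab.symm hP₂ hQ
      (fun z hz => hPQ z (by simp [Walk.mem_support_append_iff, hz])) hp hq
      (fun z hz => hPC z (by simp [Walk.mem_support_append_iff, hz])) hQC haP₂
      (hPQ a (by simp)) ?_
    intro h
    exact haP₂ (hPC a (by simp) h ▸ P₂.end_mem_support)
  by_cases hcP : c ∈ P.support
  · exact through P Q hab hac hbc hP hQ hPQ hp hq hPC hQC hcP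
  by_cases hcQ : c ∈ Q.support
  · exact through Q P hab.symm hbc hac hQ hP (fun z hz hz' => hPQ z hz' hz) hq hp hQC hPC hcQ
  by_cases hcC : c ∈ C.support
  -- The trivial path at `c` replaces `P` or `Q`, and the avoided vertex is one of `a`, `b` that
  -- lies off `C`.
  · by_cases ha : a ∈ C.support
    · have hb : b ∉ C.support := fun hb => hall ⟨ha, hb, hcC⟩
      refine hG.false_of_disjoint_paths hk hC (by omega) hac hab hbc.symm hP .nil (q := c) ?_ hp
        hcC hPC (by simp) (fun h => hPQ b h (by simp)) (by simpa using hbc.ne) hb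
      rintro z hz hz'
      obtain rfl : z = c := by simpa using hz'
      exact hcP hz
    · refine hG.false_of_disjoint_paths hk hC (by omega) hbc hab.symm hac.symm hQ .nil (q := c) ?_
        hq hcC hQC (by simp) (hPQ a (by simp)) (by simpa using hac.ne) ha
      rintro z hz hz'
      obtain rfl : z = c := by simpa using hz'
      exact hcQ hz
  · exact hG.false_of_disjoint_paths hk hC (by omega) hab hac hbc hP hQ hPQ hp hq hPC hQC hcP hcQ
      hcC

/-! ### Degree and edge bounds -/

/-- A set of integers in an interval without two consecutive elements. -/
theorem _root_.Finset.two_mul_card_le_of_no_consecutive {I : Finset ℕ} {a b : ℕ}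
    (hI : ∀ i ∈ I, a ≤ i ∧ i ≤ b) (hcons : ∀ i ∈ I, i + 1 ∉ I) : 2 * I.card ≤ b + 2 - a := by
  have hd : Disjoint I (I.map (addRightEmbedding 1)) := by
    rw [Finset.disjoint_left]
    intro i hi hi'
    obtain ⟨j, hj, rfl⟩ := Finset.mem_map.1 hi'
    exact hcons j hj hi
  have hsub : I ∪ I.map (addRightEmbedding 1) ⊆ Finset.Icc a (b + 1) := by
    intro i hi
    rcases Finset.mem_union.1 hi with h | h
    · have := hI i h
      rw [Finset.mem_Icc]; omega
    · obtain ⟨j, hj, rfl⟩ := Finset.mem_map.1 h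
      have := hI j hj
      rw [Finset.mem_Icc, addRightEmbedding_apply]; omega
  have := Finset.card_le_card hsub
  rw [Finset.card_union_of_disjoint hd, Finset.card_map, Nat.card_Icc] at this
  omega

/-- If consecutive elements exist, `hcons` gives `P ≤ 2 * k - 4`. At most `k - 2` elements are at
most `k - 2`; those from `k - 1` to `P` are pairwise non-consecutive, so there are at most `(k - 1)
/ 2` of them. -/
theorem two_mul_card_lt_of_consecutive_bound {I : Finset ℕ} {k P : ℕ} (hk : 3 ≤ k)
    (hI : ∀ i ∈ I, 1 ≤ i ∧ i ≤ P) (hP : P + 1 < 3 * k)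
    (hcons : ∀ i ∈ I, i + 1 ∈ I → i + 2 ≤ k ∧ P + 2 ≤ k + i) : 2 * I.card < 3 * k := by
  by_cases h : ∀ i ∈ I, i + 1 ∉ I
  · have := Finset.two_mul_card_le_of_no_consecutive hI h
    omega
  push Not at h
  obtain ⟨i, hi, hi'⟩ := h
  have h1 := hcons i hi hi'
  have h2 : (I.filter (· + 2 ≤ k)).card ≤ k - 2 := by
    have : I.filter (· + 2 ≤ k) ⊆ Finset.Icc 1 (k - 2) := by
      intro j hj
      rw [Finset.mem_filter] at hj
      have := hI j hj.1
      rw [Finset.mem_Icc]; omega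
    simpa using Finset.card_le_card this
  have h3 := Finset.two_mul_card_le_of_no_consecutive (I := I.filter (¬ · + 2 ≤ k)) (a := k - 1)
    (b := P) (by
      intro j hj
      rw [Finset.mem_filter] at hj
      have := hI j hj.1
      omega) (by
      intro j hj hj'
      rw [Finset.mem_filter] at hj hj'
      have := hcons j hj.1 hj'.1
      omega)
  have h4 := Finset.card_filter_add_card_filter_not (s := I) (· + 2 ≤ k)
  omega

/-- A graph without two consecutive long cycle lengths and without very long cycles has a vertex
of small degree. -/
theorem NoConsecutiveCycles.exists_degree_le [Fintype V] [Nonempty V] [DecidableRel G.Adj] {k : ℕ}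
    (hG : G.NoConsecutiveCycles k) (hk : 3 ≤ k) (hlen : ∀ ℓ, G.HasCycleLength ℓ → ℓ < 3 * k) :
    ∃ v, G.degree v ≤ (3 * k - 1) / 2 := by
  classical
  obtain ⟨x, y, p, hp, hmax⟩ := Walk.exists_isPath_forall_isPath_length_le_length G
  refine ⟨x, ?_⟩
  have hnb : ∀ z, G.Adj x z → z ∈ p.support := by
    intro z hz
    by_contra hzp
    have := hmax _ _ (.cons hz.symm p) (hp.cons (h := hz.symm) hzp)
    simp at this
  let I := (Finset.Icc 1 p.length).filter fun i => G.Adj x (p.getVert i)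
  have hI : ∀ i, i ∈ I ↔ (1 ≤ i ∧ i ≤ p.length) ∧ G.Adj x (p.getVert i) := by
    intro i; simp [I]
  have hdeg : G.degree x ≤ I.card := by
    rw [← G.card_neighborFinset_eq_degree]
    refine (Finset.card_le_card (t := I.image p.getVert) fun z hz => ?_).trans
      Finset.card_image_le
    rw [mem_neighborFinset] at hz
    obtain ⟨i, rfl, hi⟩ := Walk.mem_support_iff_exists_getVert.1 (hnb z hz)
    rw [Finset.mem_image]
    refine ⟨i, (hI i).2 ⟨⟨?_, hi⟩, hz⟩, rfl⟩
    rcases Nat.eq_zero_or_pos i with rfl | h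
    · simp at hz
    · exact h
  rcases I.eq_empty_or_nonempty with hIe | hIne
  · simp [hIe] at hdeg
    omega
  let P := I.max' hIne
  have hPI : P ∈ I := I.max'_mem hIne
  have hle : ∀ i ∈ I, i ≤ P := fun i hi => I.le_max' i hi
  obtain ⟨⟨hP1, hPl⟩, hPadj⟩ := (hI P).1 hPI
  have hlt : 2 * I.card < 3 * k := by
    refine two_mul_card_lt_of_consecutive_bound (P := P) hk
      (fun i hi => ⟨((hI i).1 hi).1.1, hle i hi⟩) ?_ ?_
    · rcases Nat.lt_or_ge P 2 with h | h
      · omega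
      · have := hlen _ ((hp.take P).hasCycleLength hPadj (by simp; omega))
        simp at this
        omega
    · intro i hi hi'
      obtain ⟨⟨hi1, hil⟩, hiadj⟩ := (hI i).1 hi
      obtain ⟨⟨-, hil'⟩, hiadj'⟩ := (hI (i + 1)).1 hi'
      have hadj : G.Adj (p.getVert i) (p.getVert (i + 1)) := p.adj_getVert_succ (by omega)
      have hinj := hp.getVert_injOn
      -- In the triangle on `x` and the path vertices `i`, `i + 1`, the initial segment up to `i`
      -- avoids `i + 1`, while the segment from `i + 1` to `P`, followed by the edge to `x`, avoids
      -- `i`.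
      constructor
      · have := hG.length_add_one_lt hk hiadj hiadj' hadj (hp.take i) (by
          intro hm
          obtain ⟨j, hj, hj'⟩ := Walk.mem_support_iff_exists_getVert.1 hm
          simp at hj hj'
          have := hinj (by simp; omega) (by simp; omega) hj
          omega)
        simp at this
        omega
      · let R := (p.take P).drop (i + 1)
        have hgv : (p.take P).getVert (i + 1) = p.getVert (i + 1) := by
          simp [hle _ hi']
        have hR : R.IsPath := (hp.take P).drop _
        have hRs : ∀ j, j ≤ i → p.getVert j ∉ R.support := by
          intro j hj hm
          obtain ⟨m, hm, hm'⟩ := Walk.mem_support_iff_exists_getVert.1 hm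
          simp [R] at hm hm'
          have := hinj (by simp; omega) (by simp; omega) hm
          have := hle _ hi'
          omega
        have hx : x ∉ R.support := by simpa using hRs 0 (by omega)
        have hW : (Walk.cons hPadj R.reverse).IsPath := hR.reverse.cons (by simpa using hx)
        have := hG.length_add_one_lt hk (hgv ▸ hiadj') hiadj (hgv ▸ hadj.symm) hW (by
          rw [Walk.support_cons, List.mem_cons, Walk.support_reverse, List.mem_reverse]
          rintro (h | h)
          · exact hiadj.ne' h
          · exact hRs i le_rfl h)
        simp [R] at this
        omega
  omega

/-- The edge bound, by repeatedly deleting a vertex of small degree. -/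
theorem NoConsecutiveCycles.card_edgeFinset_le {k : ℕ} (hk : 3 ≤ k) (n : ℕ) :
    ∀ {V : Type*} [Fintype V] [DecidableEq V] (G : SimpleGraph V) [DecidableRel G.Adj],
      Fintype.card V = n + 1 → G.NoConsecutiveCycles k →
      (∀ ℓ, G.HasCycleLength ℓ → ℓ < 3 * k) → G.edgeFinset.card ≤ (3 * k - 1) / 2 * n := by
  induction n with
  | zero =>
    intro V _ _ G _ hV _ _
    have := G.card_edgeFinset_le_card_choose_two
    simpa [hV] using this
  | succ n ih =>
    intro V _ _ G _ hV hG hlen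
    have : Nonempty V := Fintype.card_pos_iff.1 (by omega)
    obtain ⟨v, hv⟩ := hG.exists_degree_le hk hlen
    -- Both cycle-length hypotheses pass to induced subgraphs, unlike `BlocksHaveTriangle`.
    have f : G.induce {v}ᶜ ↪g G := Embedding.induce _
    have h1 := ih (G.induce {v}ᶜ) (by rw [Fintype.card_compl_set]; simp [hV])
      (fun ℓ hℓ h h' => hG ℓ hℓ (h.map f) (h'.map f)) (fun ℓ h => hlen ℓ (h.map f))
    have h2 := G.card_edgeFinset_induce_compl_singleton v
    rw [G.card_edgeFinset_deleteIncidenceSet] at h2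
    have h3 := G.degree_le_card_edgeFinset v
    rw [Nat.mul_succ]
    omega

end SimpleGraph


/-! ### Bridges and the effect of a new edge -/

namespace SimpleGraph

variable {V : Type*} {G H : SimpleGraph V}

theorem Walk.IsPath.cyclicPair {a b : V} {W : G.Walk a b} (hW : W.IsPath) (hab : G.Adj a b)
    (hl : 2 ≤ W.length) {e : Sym2 V} (he : e ∈ W.edges) : G.CyclicPair s(a, b) e := by
  refine ⟨b, .cons hab.symm W, ?_, by simp [Sym2.eq_swap], by simp [he]⟩
  rw [Walk.cons_isCycle_iff]
  refine ⟨hW, fun h => ?_⟩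
  rw [Sym2.eq_swap] at h
  have := hW.length_eq_one_of_mem_edges h
  omega

theorem cyclicPair_of_triangle {a b c : V} (hab : G.Adj a b) (hac : G.Adj a c) (hbc : G.Adj b c) :
    G.CyclicPair s(a, b) s(b, c) := by
  have hW : (Walk.cons hac (.cons hbc.symm .nil)).IsPath := by
    simp [Walk.isPath_def, hab.ne, hac.ne, hbc.ne']
  exact hW.cyclicPair hab (by simp) (by simp [Sym2.eq_swap])

/-- `a` and `b` are joined by an edge lying on no cycle. -/
def BridgeAdj (G : SimpleGraph V) (a b : V) : Prop :=
  G.Adj a b ∧ ¬ G.CyclicPair s(a, b) s(a, b)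

theorem BridgeAdj.symm {a b : V} (h : G.BridgeAdj a b) : G.BridgeAdj b a :=
  ⟨h.1.symm, by rw [Sym2.eq_swap]; exact h.2⟩

/-- There is no path of four bridges. -/
def NoLongBridgePath (G : SimpleGraph V) : Prop :=
  ∀ a b c d e, [a, b, c, d, e].Nodup → G.BridgeAdj a b → G.BridgeAdj b c → G.BridgeAdj c d →
    G.BridgeAdj d e → False

theorem NoLongBridgePath.of_imp (hG : G.NoLongBridgePath)
    (h : ∀ a b, H.BridgeAdj a b → G.BridgeAdj a b) : H.NoLongBridgePath :=
  fun a b c d e hn h1 h2 h3 h4 => hG a b c d e hn (h _ _ h1) (h _ _ h2) (h _ _ h3) (h _ _ h4)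

theorem edgeSet_sup_edge_subset {u v : V} {e : Sym2 V} (he : e ∈ (G ⊔ edge u v).edgeSet)
    (hne : e ≠ s(u, v)) : e ∈ G.edgeSet := by
  induction e with | h a b =>
  simp only [mem_edgeSet, sup_adj, edge_adj] at he ⊢
  rcases he with h | ⟨h, -⟩
  · exact h
  · exact (hne (by rw [Sym2.eq_iff]; tauto)).elim

theorem sup_edge_adj_self {u v : V} (h : u ≠ v) : (G ⊔ edge u v).Adj u v := by
  simp [edge_adj, h]

theorem CyclicPair.of_sup_edge {u v : V} {e : Sym2 V} (h : (G ⊔ edge u v).CyclicPair e e) :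
    G.CyclicPair e e ∨ (G ⊔ edge u v).CyclicPair e s(u, v) := by
  obtain ⟨w, C, hC, he, -⟩ := h
  by_cases huv : s(u, v) ∈ C.edges
  · exact .inr ⟨w, C, hC, he, huv⟩
  · have ht : ∀ d ∈ C.edges, d ∈ G.edgeSet := fun d hd =>
      edgeSet_sup_edge_subset (C.edges_subset_edgeSet hd) (fun h => huv (h ▸ hd))
    exact .inl ⟨w, C.transfer G ht, hC.transfer ht, by simpa, by simpa⟩

theorem BridgeAdj.of_sup_edge {u v a b : V} (h : (G ⊔ edge u v).BridgeAdj a b) :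
    G.BridgeAdj a b ∨ s(a, b) = s(u, v) := by
  by_cases he : s(a, b) = s(u, v)
  · exact .inr he
  · exact .inl ⟨edgeSet_sup_edge_subset (e := s(a, b)) h.1 he, fun hc => h.2 (hc.mono le_sup_left)⟩

/-- A path all of whose edges are bridges is the only path between its ends. -/
theorem Walk.IsPath.eq_of_forall_not_cyclicPair {u v : V} {p q : G.Walk u v} (hp : p.IsPath)
    (hq : q.IsPath) (h : ∀ e ∈ p.edges, ¬ G.CyclicPair e e) : q = p := by
  induction p with
  | nil => exact (Walk.isPath_iff_nil.1 hq).eq_nil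
  | @cons a b c hab p ih =>
    have hb : G.IsBridge s(a, b) := by
      rw [isBridge_iff_forall_cycle_notMem hab]
      exact fun w C hC he => h _ (by simp) ⟨w, C, hC, he, he⟩
    -- This walk from `a` to `b` must cross the bridge; the tail `p` never returns to `a`, so `q`
    -- crosses it, necessarily as its first step.
    have hmem := isBridge_iff_forall_walk_mem_edges.1 hb (q.append p.reverse)
    rw [Walk.edges_append, List.mem_append] at hmem
    rw [Walk.cons_isPath_iff] at hp
    have hq' : s(a, b) ∈ q.edges := hmem.resolve_right fun h' =>
      hp.2 (p.fst_mem_support_of_mem_edges (by simpa using h'))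
    have hsnd := hq.eq_snd_of_mem_edges hq'
    cases q with
    | nil => simp at hq'
    | cons hab' q =>
      simp only [Walk.snd_cons] at hsnd
      subst hsnd
      rw [Walk.cons_isPath_iff] at hq
      rw [ih hp.1 hq.1 fun e he => h e (by simp [he])]

/-- Adding an edge keeps a triangle in every block, unless it closes a long path of bridges. -/
theorem BlocksHaveTriangle.sup_edge (hG : G.BlocksHaveTriangle) {x y : V} (hxy : x ≠ y)
    (hadj : ¬ G.Adj x y) :
    (G ⊔ edge x y).BlocksHaveTriangle ∨
      ∃ p : G.Walk x y, p.IsPath ∧ 3 ≤ p.length ∧ ∀ e ∈ p.edges, ¬ G.CyclicPair e e := by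
  classical
  have hH := sup_edge_adj_self (G := G) hxy
  have key : (∃ f, (G ⊔ edge x y).TriangleEdge f ∧ (G ⊔ edge x y).CyclicPair s(x, y) f) →
      (G ⊔ edge x y).BlocksHaveTriangle := by
    rintro ⟨f, hf, hxf⟩ e he
    rcases he.of_sup_edge with h | h
    · obtain ⟨f, ⟨a, b, c, h1, h2, h3, rfl⟩, hef⟩ := hG e h
      exact ⟨_, ⟨a, b, c, .inl h1, .inl h2, .inl h3, rfl⟩, hef.mono le_sup_left⟩
    · exact ⟨f, hf, h.trans hxf⟩
  by_cases hc : (G ⊔ edge x y).CyclicPair s(x, y) s(x, y)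
  · obtain ⟨w, C, hC, he, -⟩ := hc
    have hr : G.Reachable x y :=
      ((adj_and_reachable_delete_edges_iff_exists_cycle.2 ⟨w, C, hC, he⟩).2).mono (by
        intro a b hab
        rw [deleteEdges_adj] at hab
        exact edgeSet_sup_edge_subset (e := s(a, b)) hab.1 hab.2)
    obtain ⟨p, hp⟩ := hr.exists_isPath
    have hl : 2 ≤ p.length := by
      by_contra hlt
      have h0 : p.length ≠ 0 := fun h => hxy (Walk.eq_of_length_eq_zero h)
      exact hadj (Walk.adj_of_length_eq_one (p := p) (by omega))
    have hp' := hp.mapLe (le_sup_left : G ≤ G ⊔ edge x y)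
    by_cases hcyc : ∃ g ∈ p.edges, G.CyclicPair g g
    · obtain ⟨g, hg, hgg⟩ := hcyc
      -- The new edge joins the block of `g` and inherits its triangle.
      obtain ⟨f, ⟨a, b, c, h1, h2, h3, rfl⟩, hgf⟩ := hG g hgg
      exact .inl (key ⟨_, ⟨a, b, c, .inl h1, .inl h2, .inl h3, rfl⟩,
        (hp'.cyclicPair hH (by simpa) (by simpa)).trans (hgf.mono le_sup_left)⟩)
    · push Not at hcyc
      rcases Nat.lt_or_ge p.length 3 with h | h
      · left
        match p, hl, h with
        | .cons (v := z) h1 (.cons h2 .nil), _, _ =>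
          exact key ⟨s(x, y), ⟨x, y, z, hH, .inl h1, .inl h2.symm, rfl⟩, w, C, hC, he, he⟩
      · exact .inr ⟨p, hp, h, hcyc⟩
  · refine .inl fun e he => ?_
    rcases he.of_sup_edge with h | h
    · obtain ⟨f, ⟨a, b, c, h1, h2, h3, rfl⟩, hef⟩ := hG e h
      exact ⟨_, ⟨a, b, c, .inl h1, .inl h2, .inl h3, rfl⟩, hef.mono le_sup_left⟩
    · exact (hc h.symm.left).elim

end SimpleGraph

/-! ### Mini's strategy -/

open SimpleGraph

variable {V : Type*} {𝓒 : Set FinGraph}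

theorem IsCycleFamily.familyFree_iff (h𝓒 : IsCycleFamily 𝓒) {G : SimpleGraph V} :
    FamilyFree 𝓒 G ↔ ∀ ℓ, 3 ≤ ℓ → cyc ℓ ∈ 𝓒 → ¬ G.HasCycleLength ℓ := by
  constructor
  · intro h ℓ hℓ hmem hc
    exact h _ hmem ((cycleGraph_isContained_iff (by omega)).2 hc)
  · rintro h F hF hc
    obtain ⟨ℓ, hℓ, rfl⟩ := h𝓒 F hF
    exact h ℓ hℓ hF ((cycleGraph_isContained_iff (by omega)).1 hc)

/-- Joining two vertices all of whose connecting paths have length two creates only triangles. -/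
theorem IsCycleFamily.legalMove_of_path_length (h𝓒 : IsCycleFamily 𝓒) (h3 : cyc 3 ∉ 𝓒)
    {G : SimpleGraph V} (hG : FamilyFree 𝓒 G) {a c : V} (hac : a ≠ c)
    (hp : ∀ q : G.Walk a c, q.IsPath → q.length = 2) : LegalMove 𝓒 G (G ⊔ edge a c) := by
  refine ⟨a, c, hac, fun h => ?_, rfl, ?_⟩
  · simpa using hp h.toWalk h.isPath_toWalk
  · rw [h𝓒.familyFree_iff] at hG ⊢
    rintro ℓ hℓ hmem ⟨w, C, hC, hCl⟩
    have htr : ∀ {u v : V} (W : (G ⊔ edge a c).Walk u v), s(a, c) ∉ W.edges →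
        ∀ d ∈ W.edges, d ∈ G.edgeSet := fun W hW d hd =>
      edgeSet_sup_edge_subset (W.edges_subset_edgeSet hd) (fun h => hW (h ▸ hd))
    by_cases he : s(a, c) ∈ C.edges
    · obtain ⟨A, B, hA, hB, -, -, hed, hl⟩ := hC.exists_arcs (C.fst_mem_support_of_mem_edges he)
        (C.snd_mem_support_of_mem_edges he) hac
      have key : ∀ A B : (G ⊔ edge a c).Walk a c, A.IsPath → B.IsPath →
          A.length + B.length = C.length → s(a, c) ∈ A.edges → False := by
        intro A B hA hB hl hAe
        have h1 := hA.length_eq_one_of_mem_edges hAe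
        have hBe : s(a, c) ∉ B.edges := fun h => by
          have := hB.length_eq_one_of_mem_edges h
          omega
        have := hp (B.transfer G (htr B hBe)) (hB.transfer _)
        rw [Walk.length_transfer] at this
        obtain rfl : ℓ = 3 := by omega
        exact h3 hmem
      rcases (hed _).1 he with h | h
      · exact key A B hA hB hl h
      · exact key B A hB hA (by omega) h
    · exact hG ℓ hℓ hmem ⟨w, C.transfer G (htr C he), hC.transfer _, by simpa⟩

/-- Closing a triangle over two adjacent bridges. -/
theorem IsCycleFamily.exists_legalMove_of_bridgeAdj (h𝓒 : IsCycleFamily 𝓒) (h3 : cyc 3 ∉ 𝓒)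
    {H : SimpleGraph V} (hH : FamilyFree 𝓒 H) (hT : H.BlocksHaveTriangle) {a b c : V}
    (hac : a ≠ c) (hab : H.BridgeAdj a b) (hbc : H.BridgeAdj b c) :
    ∃ K, LegalMove 𝓒 H K ∧ K.BlocksHaveTriangle ∧
      ∀ u v, K.BridgeAdj u v → H.BridgeAdj u v ∧ s(u, v) ≠ s(a, b) := by
  have hW : (Walk.cons hab.1 (.cons hbc.1 .nil)).IsPath := by
    simp [Walk.isPath_def, hab.1.ne, hbc.1.ne, hac]
  have huniq : ∀ q : H.Walk a c, q.IsPath → q = .cons hab.1 (.cons hbc.1 .nil) := fun q hq =>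
    hW.eq_of_forall_not_cyclicPair hq (by simpa using ⟨hab.2, hbc.2⟩)
  have hlegal := h𝓒.legalMove_of_path_length h3 hH hac fun q hq => by rw [huniq q hq]; simp
  have hnadj : ¬ H.Adj a c := fun h => by
    have := congrArg Walk.length (huniq h.toWalk h.isPath_toWalk)
    simp at this
  refine ⟨_, hlegal, (hT.sup_edge hac hnadj).resolve_right ?_, ?_⟩
  · rintro ⟨p, hp, hl, -⟩
    rw [huniq p hp] at hl
    simp at hl
  · have hK := sup_edge_adj_self (G := H) hac
    have h1 : (H ⊔ edge a c).CyclicPair s(a, b) s(b, c) :=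
      cyclicPair_of_triangle (.inl hab.1) hK (.inl hbc.1)
    have h2 : (H ⊔ edge a c).CyclicPair s(a, c) s(c, b) :=
      cyclicPair_of_triangle hK (.inl hab.1) (.inl hbc.1.symm)
    intro u v huv
    refine ⟨huv.of_sup_edge.resolve_right fun h => huv.2 (h ▸ h2.left), fun h => ?_⟩
    exact huv.2 (h ▸ h1.left)

/-- Closing a triangle in a four-cycle made of three bridges and a new edge. -/
theorem IsCycleFamily.exists_legalMove_of_four_cycle (h𝓒 : IsCycleFamily 𝓒) (h3 : cyc 3 ∉ 𝓒)
    {G : SimpleGraph V} {x a b y : V} (hH : FamilyFree 𝓒 (G ⊔ edge x y))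
    (hT : G.BlocksHaveTriangle) (hn : [x, a, b, y].Nodup)
    (hxa : G.BridgeAdj x a) (hab : G.BridgeAdj a b) (hby : G.BridgeAdj b y) :
    ∃ K, LegalMove 𝓒 (G ⊔ edge x y) K ∧ K.BlocksHaveTriangle ∧
      ∀ u v, K.BridgeAdj u v → G.BridgeAdj u v := by
  simp only [List.nodup_cons, List.mem_cons, List.not_mem_nil, or_false, not_or,
    List.nodup_nil, not_false_eq_true, and_true] at hn
  obtain ⟨⟨hxa', hxb, hxy⟩, ⟨hab', hay⟩, hby'⟩ := hn
  have hW : (Walk.cons hxa.1 (.cons hab.1 .nil)).IsPath := by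
    simp [Walk.isPath_def, hxa', hxb, hab']
  have htr : ∀ {u v : V} (W : (G ⊔ edge x y).Walk u v), s(x, y) ∉ W.edges →
      ∀ d ∈ W.edges, d ∈ G.edgeSet := fun W hW d hd =>
    edgeSet_sup_edge_subset (W.edges_subset_edgeSet hd) (fun h => hW (h ▸ hd))
  -- A path from `x` to `b` using the new edge must continue along the bridge `yb`; any other is the
  -- bridge path through `a`. Both have length two.
  have hlegal := h𝓒.legalMove_of_path_length h3 hH hxb fun q hq => by
    by_cases hq' : s(x, y) ∈ q.edges
    · have hsnd := hq.eq_snd_of_mem_edges hq'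
      cases q with
      | nil => simp at hq'
      | cons hxy' q =>
        simp only [Walk.snd_cons] at hsnd
        subst hsnd
        rw [Walk.cons_isPath_iff] at hq
        have hqe : s(x, y) ∉ q.edges := fun h => hq.2 (q.fst_mem_support_of_mem_edges h)
        have := hby.symm.1.isPath_toWalk.eq_of_forall_not_cyclicPair
          (hq.1.transfer (htr q hqe)) (by simpa using hby.symm.2)
        have := congrArg Walk.length this
        simpa using this
    · have := hW.eq_of_forall_not_cyclicPair (hq.transfer (htr q hq'))
        (by simpa using ⟨hxa.2, hab.2⟩)
      have := congrArg Walk.length this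
      simpa using this
  have hKxb := sup_edge_adj_self (G := G ⊔ edge x y) hxb
  have hKxy : ((G ⊔ edge x y) ⊔ edge x b).Adj x y := .inl (sup_edge_adj_self hxy)
  have hKby : ((G ⊔ edge x y) ⊔ edge x b).Adj b y := .inl (.inl hby.1)
  have h1 : ((G ⊔ edge x y) ⊔ edge x b).CyclicPair s(x, b) s(b, y) :=
    cyclicPair_of_triangle hKxb hKxy hKby
  have h2 : ((G ⊔ edge x y) ⊔ edge x b).CyclicPair s(x, y) s(y, b) :=
    cyclicPair_of_triangle hKxy hKxb hKby.symm
  refine ⟨_, hlegal, ?_, ?_⟩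
  · intro e he
    rcases he.of_sup_edge with h | h
    · rcases h.of_sup_edge with h | h
      · obtain ⟨f, ⟨a, b, c, h1, h2, h3, rfl⟩, hef⟩ := hT e h
        exact ⟨_, ⟨a, b, c, .inl (.inl h1), .inl (.inl h2), .inl (.inl h3), rfl⟩,
          (hef.mono le_sup_left).mono le_sup_left⟩
      · exact ⟨_, ⟨x, y, b, hKxy, hKxb, hKby.symm, rfl⟩, h.mono le_sup_left⟩
    · exact ⟨_, ⟨x, b, y, hKxb, hKxy, hKby, rfl⟩, h⟩
  · intro u v huv
    have h := huv.of_sup_edge.resolve_right fun h => huv.2 (h ▸ h1.left)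
    exact h.of_sup_edge.resolve_right fun h => huv.2 (h ▸ h2.left)

/-- Mini can answer every move of Max, maintaining a triangle in every block and no long path of
bridges; if the game ends with Max's move, then every block still has a triangle. -/
theorem IsCycleFamily.exists_response (h𝓒 : IsCycleFamily 𝓒) (h3 : cyc 3 ∉ 𝓒)
    {G H : SimpleGraph V} (hT : G.BlocksHaveTriangle) (hB : G.NoLongBridgePath)
    (hGH : LegalMove 𝓒 G H) :
    (∃ K, LegalMove 𝓒 H K ∧ K.BlocksHaveTriangle ∧ K.NoLongBridgePath) ∨
      ((¬ ∃ K, LegalMove 𝓒 H K) ∧ H.BlocksHaveTriangle) := by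
  obtain ⟨x, y, hxy, hadj, rfl, hfree⟩ := hGH
  rcases hT.sup_edge hxy hadj with hHT | ⟨p, hp, hl, hcut⟩
  swap
  · left
    match p, hp, hl, hcut with
    | .cons (v := a) h1 (.cons (v := b) h2 (.cons (v := c) h3' q)), hp, _, hcut =>
      have hn := hp.support_nodup
      have hxa : G.BridgeAdj x a := ⟨h1, hcut _ (by simp)⟩
      have hab : G.BridgeAdj a b := ⟨h2, hcut _ (by simp)⟩
      have hbc : G.BridgeAdj b c := ⟨h3', hcut _ (by simp)⟩
      -- `hB` leaves exactly three bridges, so the new edge closes a four-cycle.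
      cases q with
      | nil =>
        obtain ⟨K, hK, hKT, hKB⟩ := h𝓒.exists_legalMove_of_four_cycle h3 hfree hT
          (by simpa using hn) hxa hab hbc
        exact ⟨K, hK, hKT, hB.of_imp hKB⟩
      | @cons _ d _ h4 q =>
        refine (hB x a b c d ?_ hxa hab hbc ⟨h4, hcut _ (by simp)⟩).elim
        refine hn.sublist ?_
        simp only [Walk.support_cons]
        rw [← Walk.cons_tail_support]
        simp
  by_cases h1 : ∃ a b c, a ≠ c ∧ (G ⊔ edge x y).BridgeAdj a b ∧ (G ⊔ edge x y).BridgeAdj b c ∧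
      s(a, b) = s(x, y)
  -- Max's edge is a bridge meeting another one; a triangle absorbs it, so all remaining bridges
  -- come from `G`.
  · obtain ⟨a, b, c, hac, hab, hbc, he⟩ := h1
    obtain ⟨K, hK, hKT, hKB⟩ := h𝓒.exists_legalMove_of_bridgeAdj h3 hfree hHT hac hab hbc
    exact .inl ⟨K, hK, hKT, hB.of_imp fun u v huv =>
      (hKB u v huv).1.of_sup_edge.resolve_right fun h => (hKB u v huv).2 (h.trans he.symm)⟩
  by_cases h2 : ∃ a b c, a ≠ c ∧ (G ⊔ edge x y).BridgeAdj a b ∧ (G ⊔ edge x y).BridgeAdj b c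
  · obtain ⟨a, b, c, hac, hab, hbc⟩ := h2
    obtain ⟨K, hK, hKT, hKB⟩ := h𝓒.exists_legalMove_of_bridgeAdj h3 hfree hHT hac hab hbc
    refine .inl ⟨K, hK, hKT, NoLongBridgePath.of_imp (G := G ⊔ edge x y) ?_
      fun u v huv => (hKB u v huv).1⟩
    -- Max's edge is not a bridge adjacent to another, so two adjacent bridges are both old.
    have hold : ∀ {u v w}, u ≠ w → (G ⊔ edge x y).BridgeAdj u v → (G ⊔ edge x y).BridgeAdj v w →
        G.BridgeAdj u v := fun {u v w} huw huv hvw =>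
      huv.of_sup_edge.resolve_right fun h => h1 ⟨u, v, w, huw, huv, hvw, h⟩
    intro a b c d e hn hab hbc hcd hde
    have hn' := hn
    simp only [List.nodup_cons, List.mem_cons, List.not_mem_nil, or_false, not_or] at hn'
    exact hB a b c d e hn (hold hn'.1.2.1 hab hbc) (hold hn'.2.1.2.1 hbc hcd)
      (hold hn'.2.2.1.2 hcd hde) (hold (Ne.symm hn'.2.2.1.2) hde.symm hcd.symm).symm
  -- No two bridges meet now, so any legal move preserves the invariant.
  by_cases hmove : ∃ K, LegalMove 𝓒 (G ⊔ edge x y) K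
  · obtain ⟨K, hK⟩ := hmove
    refine .inl ⟨K, hK, ?_⟩
    obtain ⟨u, v, huv, hnadj, rfl, -⟩ := hK
    constructor
    · refine (hHT.sup_edge huv hnadj).resolve_right ?_
      rintro ⟨p, hp, hl, hcut⟩
      match p, hp, hl, hcut with
      | .cons (v := a) h4 (.cons (v := b) h5 q), hp, _, hcut =>
        refine h2 ⟨u, a, b, ?_, ⟨h4, hcut _ (by simp)⟩, ⟨h5, hcut _ (by simp)⟩⟩
        rintro rfl
        simp [Walk.cons_isPath_iff] at hp
    · intro a b c d e hn hab hbc hcd hde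
      simp only [List.nodup_cons, List.mem_cons, List.not_mem_nil, or_false, not_or] at hn
      -- Both halves of a four-bridge path would have to contain the single new edge.
      have hmeet : ∀ {a b c}, a ≠ c → ((G ⊔ edge x y) ⊔ edge u v).BridgeAdj a b →
          ((G ⊔ edge x y) ⊔ edge u v).BridgeAdj b c → s(a, b) = s(u, v) ∨ s(b, c) = s(u, v) := by
        intro a b c hac hab hbc
        rcases hab.of_sup_edge with h | h
        · exact .inr (hbc.of_sup_edge.resolve_left fun h' => h2 ⟨a, b, c, hac, h, h'⟩)
        · exact .inl h
      have := hmeet hn.1.2.1 hab hbc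
      have := hmeet hn.2.2.1.2 hcd hde
      simp only [Sym2.eq_iff] at *
      grind
  · exact .inr ⟨hmove, hHT⟩



/-! ### From the strategy to the game value -/

theorem gameValue_of_terminal [Finite V] (p : Player) {G : SimpleGraph V}
    (h : ¬ ∃ H, LegalMove 𝓒 G H) : gameValue 𝓒 p G = G.edgeSet.ncard := by
  rw [gameValue.eq_def, if_neg h]

theorem gameValue_mx_le [Finite V] {G : SimpleGraph V} {N : ℕ} (hex : ∃ H, LegalMove 𝓒 G H)
    (h : ∀ H, LegalMove 𝓒 G H → gameValue 𝓒 .mini H ≤ N) : gameValue 𝓒 .mx G ≤ N := by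
  rw [gameValue, if_pos hex]
  exact ciSup_le' fun H => h H.1 H.2

theorem gameValue_mini_le [Finite V] {G H : SimpleGraph V} (h : LegalMove 𝓒 G H) :
    gameValue 𝓒 .mini G ≤ gameValue 𝓒 .mx H := by
  rw [gameValue.eq_def 𝓒 .mini G, if_pos ⟨H, h⟩]
  exact ciInf_le (OrderBot.bddBelow _) (⟨H, h⟩ : {H : SimpleGraph V // LegalMove 𝓒 G H})

theorem LegalMove.familyFree {G H : SimpleGraph V} (h : LegalMove 𝓒 G H) : FamilyFree 𝓒 H := by
  obtain ⟨_, _, _, _, _, h⟩ := h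
  exact h

/-- Mini's strategy bounds the value of the game. -/
theorem IsCycleFamily.gameValue_le [Finite V] (h𝓒 : IsCycleFamily 𝓒) (h3 : cyc 3 ∉ 𝓒) {N : ℕ}
    (hN : ∀ G : SimpleGraph V, FamilyFree 𝓒 G → G.BlocksHaveTriangle → G.edgeSet.ncard ≤ N)
    (G : SimpleGraph V) (hG : FamilyFree 𝓒 G) (hT : G.BlocksHaveTriangle)
    (hB : G.NoLongBridgePath) : gameValue 𝓒 .mx G ≤ N := by
  induction G using (wellFounded_gt : WellFounded ((· > ·) : SimpleGraph V → _ → Prop)).induction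
    with | _ G ih
  by_cases hex : ∃ H, LegalMove 𝓒 G H
  · refine gameValue_mx_le hex fun H hGH => ?_
    rcases h𝓒.exists_response h3 hT hB hGH with ⟨K, hHK, hKT, hKB⟩ | ⟨hterm, hHT⟩
    · exact (gameValue_mini_le hHK).trans
        (ih K (hGH.lt.trans hHK.lt) hHK.familyFree hKT hKB)
    · rw [gameValue_of_terminal _ hterm]
      exact hN H hGH.familyFree hHT
  · rw [gameValue_of_terminal _ hex]
    exact hN G hG hT

theorem IsCycleFamily.noConsecutiveCycles (h𝓒 : IsCycleFamily 𝓒) {k : ℕ} (hk : 3 ≤ k)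
    (hdense : ∀ ℓ : ℕ, k ≤ ℓ → cyc ℓ ∈ 𝓒 ∨ cyc (ℓ + 1) ∈ 𝓒) {G : SimpleGraph V}
    (hG : FamilyFree 𝓒 G) : G.NoConsecutiveCycles k := by
  rw [h𝓒.familyFree_iff] at hG
  intro ℓ hℓ h h'
  rcases hdense ℓ hℓ with hm | hm
  · exact hG ℓ (by omega) hm h
  · exact hG (ℓ + 1) (by omega) hm h'

theorem theorem1p3 (𝓒 : Set FinGraph) (h𝓒 : IsCycleFamily 𝓒) (h3 : cyc 3 ∉ 𝓒)
    (k : ℕ) (hk : 3 ≤ k) (hdense : ∀ ℓ : ℕ, k ≤ ℓ → cyc ℓ ∈ 𝓒 ∨ cyc (ℓ + 1) ∈ 𝓒)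
    (n : ℕ) (hn : 1 ≤ n) :
    (satGame n 𝓒 : ℝ) ≤ 1 / 2 * (3 * (k : ℝ) - 1) * ((n : ℝ) - 1) := by
  classical
  obtain ⟨m, rfl⟩ : ∃ m, n = m + 1 := ⟨n - 1, by omega⟩
  have hcyc : ∀ e f, ¬ (⊥ : SimpleGraph (Fin (m + 1))).CyclicPair e f := by
    rintro e f ⟨u, C, hC, -, -⟩
    exact hC.isCircuit.ne_bot rfl
  have hbot : FamilyFree 𝓒 (⊥ : SimpleGraph (Fin (m + 1))) := by
    rw [h𝓒.familyFree_iff]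
    rintro ℓ - - ⟨u, C, hC, -⟩
    exact hC.isCircuit.ne_bot rfl
  have hle : satGame (m + 1) 𝓒 ≤ (3 * k - 1) / 2 * m := by
    refine h𝓒.gameValue_le h3 (fun G hG hT => ?_) ⊥ hbot (fun e he => (hcyc _ _ he).elim)
      (fun a b c d e _ h _ _ _ => h.1)
    have hcons := h𝓒.noConsecutiveCycles hk hdense hG
    rw [← coe_edgeFinset, Set.ncard_coe_finset]
    exact NoConsecutiveCycles.card_edgeFinset_le hk m G (by simp) hcons
      (by rintro ℓ ⟨u, C, hC, rfl⟩; exact hcons.length_lt hk hT hC)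
  have h1 : (satGame (m + 1) 𝓒 : ℝ) ≤ ((3 * k - 1) / 2 : ℕ) * m := by exact_mod_cast hle
  -- The natural-number quotient rounds down, so it only strengthens the bound.
  have h2 : (((3 * k - 1) / 2 : ℕ) : ℝ) ≤ 1 / 2 * (3 * (k : ℝ) - 1) := by
    have h : (3 * k - 1) / 2 * 2 + 1 ≤ 3 * k := by omega
    have h' : (((3 * k - 1) / 2 : ℕ) : ℝ) * 2 + 1 ≤ 3 * k := by exact_mod_cast h
    linarith
  push_cast
  calc (satGame (m + 1) 𝓒 : ℝ) ≤ ((3 * k - 1) / 2 : ℕ) * m := h1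
    _ ≤ 1 / 2 * (3 * (k : ℝ) - 1) * m := by gcongr
    _ = _ := by ring
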